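/- Let $B=(\beta_n)_{n\ge 1}$ be an alternate base with period $p\ge 1$, i.e. a sequence of real numbers $\beta_n>1$ with $\beta_{n+p}=\beta_n$ for all $n\ge 1$, and put $\delta=\prod_{i=1}^p\beta_i$. For $x\in[0,1]$ the $B$-expansion $d_B(x)=x_1x_2x_3\cdots$ is produced by the greedy algorithm $r_0=x$, $x_n=\lfloor\beta_n r_{n-1}\rfloor$, $r_n=\beta_n r_{n-1}-x_n$ ($n\ge 1$), and $\mathrm{Fin}(B)$ is the set of all $x\in[0,1)$ for which $d_B(x)$ has only finitely many non-zero digits. The base $B$ has Property (PF) if for all $x,y\in\mathrm{Fin}(B)$, $x+y\in[0,1)$ implies $x+y\in\mathrm{Fin}(B)$; it has Property (F) if for all $x,y\in\mathrm{Fin}(B)$, $x+y\in[0,1)$ implies $x+y\in\mathrm{Fin}(B)$ and $x-y\in[0,1)$ implies $x-y\in\mathrm{Fin}(B)$. With $B^{(\ell)}=(\beta_n)_{n\ge\ell}$, the base $B$ is a simple Parry alternate base if for every $\ell\in\{1,\dots,p\}$ the expansion $d_{B^{(\ell)}}(1)$ has only finitely many non-zero digits. An algebraic integer $\alpha>1$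 is a Pisot number if all its conjugates other than $\alpha$ have modulus $<1$, and a Salem number if all its conjugates other than $\alpha$ have modulus $\le 1$ and at least one of them has modulus $1$. (1) If $B$ has Property (PF), then $\delta$ is a Pisot number or a Salem number, and $\beta_i\in\mathbb{Q}(\delta)$ for every $i\in\{1,\dots,p\}$. (2) If, moreover, $B$ has Property (F), then $B$ is a simple Parry alternate base, and for every embedding $\psi$ of the field $\mathbb{Q}(\delta)$ into $\mathbb{C}$ other than the identical one, the vector $(\psi(\beta_1),\dots,\psi(\beta_p))$ is not positive, i.e. not all of the numbers $\psi(\beta_1),\dots,\psi(\beta_p)$ are positive real numbers. -/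

import Mathlib

open scoped IntermediateField

noncomputable section

namespace CantorReal

/-- A Cantor real base `(β₁, β₂, …)`. Indices are shifted by one: `β n` is the entry with
number `n + 1`, so `∏_{k < n} β k` is the product of the first `n` entries. -/
def IsCantorRealBase (β : ℕ → ℝ) : Prop :=
  (∀ n, 1 < β n) ∧
    Filter.Tendsto (fun n : ℕ => ∏ k ∈ Finset.range n, β k) Filter.atTop Filter.atTop

/-- The shifted base, whose first entry is the one at position `ℓ` (counted from `0`). -/
def shift (β : ℕ → ℝ) (ℓ : ℕ) : ℕ → ℝ := fun n => β (ℓ + n)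

/-- Remainders of the greedy algorithm in base `β` started at `x`:
`r₀ = x` and `r_{n+1} = β_{n+1} r_n - ⌊β_{n+1} r_n⌋`. -/
def remainder (β : ℕ → ℝ) (x : ℝ) : ℕ → ℝ
  | 0 => x
  | n + 1 => β n * remainder β x n - (⌊β n * remainder β x n⌋₊ : ℝ)

/-- The greedy `β`-expansion of `x ∈ [0, 1]`; the digit number `n + 1` is `⌊β_{n+1} r_n⌋`. -/
def expansion (β : ℕ → ℝ) (x : ℝ) : ℕ → ℕ :=
  fun n => ⌊β n * remainder β x n⌋₊

/-- The sequences of non-negative integers with finite support. -/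
def finiteSequences : Set (ℕ → ℕ) := {s | (Function.support s).Finite}

/-- The numbers in `[0, 1)` with finite `β`-expansion. -/
def FinExp (β : ℕ → ℝ) : Set ℝ := {x | x ∈ Set.Ico (0 : ℝ) 1 ∧ expansion β x ∈ finiteSequences}

/-- Property (PF), the positive finiteness property. -/
def PropertyPF (β : ℕ → ℝ) : Prop :=
  ∀ x ∈ FinExp β, ∀ y ∈ FinExp β, x + y ∈ Set.Ico (0 : ℝ) 1 → x + y ∈ FinExp β

/-- Property (F), the finiteness property. -/
def PropertyF (β : ℕ → ℝ) : Prop :=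
  ∀ x ∈ FinExp β, ∀ y ∈ FinExp β,
    (x + y ∈ Set.Ico (0 : ℝ) 1 → x + y ∈ FinExp β) ∧
    (x - y ∈ Set.Ico (0 : ℝ) 1 → x - y ∈ FinExp β)

/-- `β` is an alternate base with period `p`, i.e. a Cantor real base that is purely periodic
with (not necessarily minimal) period `p ≥ 1`. -/
def IsAlternateBase (β : ℕ → ℝ) (p : ℕ) : Prop :=
  1 ≤ p ∧ IsCantorRealBase β ∧ Function.Periodic β p

/-- The product `δ` of the entries over one period. -/
def periodProduct (β : ℕ → ℝ) (p : ℕ) : ℝ := ∏ k ∈ Finset.range p, β k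

def EventuallyPeriodic (s : ℕ → ℕ) : Prop :=
  ∃ N q : ℕ, 1 ≤ q ∧ ∀ n, N ≤ n → s (n + q) = s n

/-- A Parry alternate base: the expansions of `1` in all the shifted bases are eventually
periodic. -/
def IsParryAlternateBase (β : ℕ → ℝ) (p : ℕ) : Prop :=
  IsAlternateBase β p ∧ ∀ ℓ < p, EventuallyPeriodic (expansion (shift β ℓ) 1)

/-- A simple Parry alternate base: the expansions of `1` in all the shifted bases are finite. -/
def IsSimpleParryAlternateBase (β : ℕ → ℝ) (p : ℕ) : Prop :=
  IsParryAlternateBase β p ∧ ∀ ℓ < p, expansion (shift β ℓ) 1 ∈ finiteSequences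

/-- The (complex) conjugates of a real number `δ` that are different from `δ`. For a `δ` which is
algebraic these are the other complex roots of its minimal polynomial over `ℚ`. -/
def otherConjugates (δ : ℝ) : Set ℂ :=
  {γ | γ ∈ (minpoly ℚ δ).rootSet ℂ ∧ γ ≠ (δ : ℂ)}

/-- Pisot numbers. -/
def IsPisot (δ : ℝ) : Prop :=
  IsIntegral ℤ δ ∧ 1 < δ ∧ ∀ γ ∈ otherConjugates δ, ‖γ‖ < 1

/-- Salem numbers. -/
def IsSalem (δ : ℝ) : Prop :=
  IsIntegral ℤ δ ∧ 1 < δ ∧ (∀ γ ∈ otherConjugates δ, ‖γ‖ ≤ 1) ∧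
    ∃ γ ∈ otherConjugates δ, ‖γ‖ = 1

/-- The identical embedding of the real field `ℚ(δ)` into `ℂ`. -/
def identicalEmbedding (δ : ℝ) : ℚ⟮δ⟯ →+* ℂ :=
  Complex.ofRealHom.comp (algebraMap ℚ⟮δ⟯ ℝ)

/-- A complex number is positive if it is a positive real number. -/
def IsPositive (z : ℂ) : Prop := ∃ r : ℝ, 0 < r ∧ z = (r : ℂ)

end CantorReal

end

/-!
Write `eₙ` for the product of the first `n` entries of `β`, so that the weights of the digits are
`1 / eₙ`, `n ≥ 1`, and `e_{n + p} = δ eₙ`.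

Part (1) rests on one relation, `PropertyPF.exists_relation`. Under (PF) every multiple `k / e_j`
in `[0, 1)` has a finite expansion. For fixed `n` and large `j`, let `k / e_j` be the least such
multiple with `k / e_j ≥ 1 / eₙ`. Greediness forces its expansion to be `1 / eₙ` followed by digits
at positions beyond `j` only, so that `k / e_j = 1 / eₙ + ∑_{i > j} x_i / e_i`, a finite sum with
digits bounded by the entries of the base. There are two consequences.

* Every weight is an integral combination of smaller ones. So the group generated by the weights in
  a long enough window of positions is stable under multiplication by `δ`, and `δ` is an algebraic
  integer (`PropertyPF.isIntegral_periodProduct`).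
* Let `φ : ℝ → ℂ` be additive with `φ (δ x) = γ φ x` and `|γ| > 1`. Then `∑ |φ (1 / e_i)|` converges,
  and the relation gives `k φ (1 / e_j) → φ (1 / eₙ)` as `j → ∞`, while `k / e_j → 1 / eₙ`. Hence
  `eₙ φ (1 / eₙ) = lim e_j φ (1 / e_j)` does not depend on `n`: on the weights, `φ` is a multiple of
  the identity (`PropertyPF.exists_map_inv_eq`).

Maps `φ` arise by composing a `ℚ(δ)`-linear projection `ℝ → ℚ(δ)` with an embedding of `ℚ(δ)` into
`ℂ` that sends `δ` to `γ`. An embedding with `|γ| > 1` therefore has `γ = δ`, which bounds the other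
conjugates of `δ` by `1`. For the identical embedding, the weights are fixed by the projection, so
they lie in `ℚ(δ)`.

Part (2): `1 / e_L - ⌊β_L⌋ / e_{L + 1}` (with `L` counted from `0`) is the scaled remainder of `1`
after one step in the base shifted by `L`, and has a finite expansion by (F). If `ψ` makes the base
positive, it is non-negative on all elements of `ℚ(δ)` with finite expansion. By (F) these include
all scaled differences `(s - t δ) / δ ^ m` and `(t δ - s) / δ ^ m` in `[0, 1)` for large `m`, where
`s` and `t` are natural numbers. So `δ` and `ψ(δ)` define the same cut in the positive rationals,
and `ψ` is the identical embedding.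
-/

namespace CantorReal

variable {β : ℕ → ℝ} {p : ℕ}

/-! ### Products of initial entries and the greedy algorithm -/

/-- The product of the first `n` entries of `β`, so that the digit with index `i` of an expansion
has weight `(entryProd β (i + 1))⁻¹`. -/
def entryProd (β : ℕ → ℝ) (n : ℕ) : ℝ := ∏ k ∈ Finset.range n, β k

lemma entryProd_zero : entryProd β 0 = 1 := by simp [entryProd]

lemma entryProd_succ (n : ℕ) : entryProd β (n + 1) = entryProd β n * β n := by
  simp [entryProd, Finset.prod_range_succ]

lemma entryProd_pos (h1 : ∀ n, 1 < β n) (n : ℕ) : 0 < entryProd β n :=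
  Finset.prod_pos fun k _ => zero_lt_one.trans (h1 k)

lemma entryProd_strictMono (h1 : ∀ n, 1 < β n) : StrictMono (entryProd β) :=
  strictMono_nat_of_lt_succ fun n => by
    rw [entryProd_succ]
    exact lt_mul_of_one_lt_right (entryProd_pos h1 n) (h1 n)

lemma one_lt_entryProd (h1 : ∀ n, 1 < β n) {n : ℕ} (hn : 1 ≤ n) : 1 < entryProd β n := by
  have := entryProd_strictMono h1 hn
  rwa [entryProd_zero] at this

lemma entryProd_add_period (hp : Function.Periodic β p) (n : ℕ) :
    entryProd β (n + p) = periodProduct β p * entryProd β n := by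
  rw [add_comm, entryProd, Finset.prod_range_add, periodProduct, entryProd]
  congr 1
  exact Finset.prod_congr rfl fun k _ => by rw [add_comm, hp]

lemma entryProd_mul_period (hp : Function.Periodic β p) (n : ℕ) :
    entryProd β (p * n) = periodProduct β p ^ n := by
  induction n with
  | zero => simp [entryProd_zero]
  | succ n ih => rw [Nat.mul_succ, entryProd_add_period hp, ih, pow_succ']

lemma remainder_succ (x : ℝ) (n : ℕ) :
    remainder β x (n + 1) = β n * remainder β x n - expansion β x n := rfl

lemma remainder_nonneg (h1 : ∀ n, 1 < β n) {x : ℝ} (hx : 0 ≤ x) (n : ℕ) :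
    0 ≤ remainder β x n := by
  induction n with
  | zero => exact hx
  | succ n ih =>
    rw [remainder_succ, sub_nonneg]
    exact Nat.floor_le (mul_nonneg (zero_lt_one.trans (h1 n)).le ih)

lemma remainder_succ_lt_one (x : ℝ) (n : ℕ) : remainder β x (n + 1) < 1 := by
  rw [remainder_succ, sub_lt_iff_lt_add']
  exact Nat.lt_floor_add_one _

lemma remainder_lt_one {x : ℝ} (hx : x < 1) (n : ℕ) : remainder β x n < 1 := by
  cases n with
  | zero => exact hx
  | succ n => exact remainder_succ_lt_one x n

lemma expansion_le (h1 : ∀ n, 1 < β n) {x : ℝ} (hx : x ∈ Set.Ico (0 : ℝ) 1) (n : ℕ) :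
    (expansion β x n : ℝ) ≤ β n := by
  have hb := zero_lt_one.trans (h1 n)
  refine (Nat.floor_le (mul_nonneg hb.le (remainder_nonneg h1 hx.1 n))).trans ?_
  exact mul_le_of_le_one_right hb.le (remainder_lt_one hx.2 n).le

lemma sum_expansion_add_remainder (h1 : ∀ n, 1 < β n) (x : ℝ) (n : ℕ) :
    ∑ i ∈ Finset.range n, (expansion β x i : ℝ) * (entryProd β (i + 1))⁻¹
      + remainder β x n * (entryProd β n)⁻¹ = x := by
  induction n with
  | zero => simp [entryProd_zero, remainder]
  | succ n ih =>
    rw [Finset.sum_range_succ, remainder_succ]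
    have h2 := (entryProd_pos h1 n).ne'
    have h3 := (zero_lt_one.trans (h1 n)).ne'
    have h4 : remainder β x n * (entryProd β n)⁻¹
        = β n * remainder β x n * (entryProd β (n + 1))⁻¹ := by
      rw [entryProd_succ]; field_simp
    linear_combination ih - h4

/-- As long as the number scaled by the product of the entries stays below `1`, the greedy
algorithm only produces zero digits. -/
lemma remainder_eq_entryProd_mul (h1 : ∀ n, 1 < β n) {x : ℝ} (hx : 0 ≤ x) {m : ℕ}
    (hm : entryProd β m * x < 1) {i : ℕ} (hi : i ≤ m) :
    remainder β x i = entryProd β i * x := by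
  induction i with
  | zero => simp [entryProd_zero, remainder]
  | succ i ih =>
    have hle : β i * remainder β x i = entryProd β (i + 1) * x := by
      rw [ih (by omega), entryProd_succ]; ring
    have hlt : entryProd β (i + 1) * x < 1 := lt_of_le_of_lt
      (mul_le_mul_of_nonneg_right ((entryProd_strictMono h1).monotone hi) hx) hm
    rw [remainder_succ, expansion, hle, Nat.floor_eq_zero.2 hlt]
    simp

lemma remainder_shift (x : ℝ) (n m : ℕ) :
    remainder β x (n + m) = remainder (shift β n) (remainder β x n) m := by
  induction m with
  | zero => rfl
  | succ m ih =>
    rw [← add_assoc, remainder, remainder, ih]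
    rfl

lemma remainder_eq_zero_of_le {x : ℝ} {n m : ℕ} (hn : remainder β x n = 0) (h : n ≤ m) :
    remainder β x m = 0 := by
  induction m, h using Nat.le_induction with
  | base => exact hn
  | succ m _ ih => simp [remainder, ih]

lemma expansion_mem_finiteSequences {x : ℝ} {n : ℕ} (hn : remainder β x n = 0) :
    expansion β x ∈ finiteSequences := by
  refine (Set.finite_lt_nat n).subset fun m hm => ?_
  by_contra h
  exact hm (by simp [expansion, remainder_eq_zero_of_le hn (not_lt.1 h)])

lemma mem_finExp_of_remainder_eq_zero {x : ℝ} (hx : x ∈ Set.Ico (0 : ℝ) 1) {n : ℕ}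
    (hn : remainder β x n = 0) : x ∈ FinExp β :=
  ⟨hx, expansion_mem_finiteSequences hn⟩

/-- A finite expansion is exact: otherwise the remainders would eventually be multiplied by all the
entries of the base, and exceed `1`. -/
lemma exists_remainder_eq_zero (hβ : IsCantorRealBase β) {x : ℝ} (hx : x ∈ FinExp β) :
    ∃ n, remainder β x n = 0 := by
  obtain ⟨N, hN⟩ := hx.2.bddAbove
  have hdig : ∀ m, N + 1 ≤ m → expansion β x m = 0 := fun m hm => by
    by_contra h
    have := hN (Function.mem_support.2 h)
    omega
  have hrem : ∀ m, N + 1 ≤ m → remainder β x m * entryProd β (N + 1)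
      = entryProd β m * remainder β x (N + 1) := fun m hm => by
    induction m, hm using Nat.le_induction with
    | base => ring
    | succ m hm ih =>
      rw [remainder_succ, hdig m hm, entryProd_succ (n := m)]
      push_cast
      linear_combination β m * ih
  refine ⟨N + 1, le_antisymm ?_ (remainder_nonneg hβ.1 hx.1.1 _)⟩
  by_contra! hpos
  obtain ⟨m, hm, hm'⟩ := ((hβ.2.eventually_gt_atTop
    (entryProd β (N + 1) / remainder β x (N + 1))).and
    (Filter.eventually_ge_atTop (N + 1))).exists
  have h2 := hrem m hm'
  have h3 := remainder_lt_one (β := β) hx.1.2 m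
  have h4 := entryProd_pos hβ.1 (N + 1)
  rw [div_lt_iff₀ hpos] at hm
  change _ < entryProd β m * _ at hm
  nlinarith

lemma exists_eq_sum_of_mem_finExp (hβ : IsCantorRealBase β) {x : ℝ} (hx : x ∈ FinExp β) :
    ∃ N, ∀ n, N ≤ n →
      x = ∑ i ∈ Finset.range n, (expansion β x i : ℝ) * (entryProd β (i + 1))⁻¹ := by
  obtain ⟨N, hN⟩ := exists_remainder_eq_zero hβ hx
  refine ⟨N, fun n hn => ?_⟩
  have := sum_expansion_add_remainder hβ.1 x n
  rw [remainder_eq_zero_of_le hN hn] at this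
  simpa using this.symm

/-! ### Consequences of Property (PF) -/

lemma inv_entryProd_mem_finExp (h1 : ∀ n, 1 < β n) {j : ℕ} (hj : 1 ≤ j) :
    (entryProd β j)⁻¹ ∈ FinExp β := by
  have hpos := entryProd_pos h1 j
  obtain ⟨i, rfl⟩ : ∃ i, j = i + 1 := ⟨j - 1, by omega⟩
  refine mem_finExp_of_remainder_eq_zero ⟨(inv_pos.2 hpos).le,
    inv_lt_one_of_one_lt₀ (one_lt_entryProd h1 hj)⟩ (n := i + 1) ?_
  have hlt : entryProd β i * (entryProd β (i + 1))⁻¹ < 1 := by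
    rw [← div_eq_mul_inv, div_lt_one hpos]
    exact entryProd_strictMono h1 (Nat.lt_succ_self i)
  have : β i * remainder β (entryProd β (i + 1))⁻¹ i = 1 := by
    rw [remainder_eq_entryProd_mul h1 (inv_pos.2 hpos).le hlt le_rfl, ← mul_assoc,
      mul_comm (β i), ← entryProd_succ, mul_inv_cancel₀ hpos.ne']
  rw [remainder_succ, expansion, this]
  simp

lemma PropertyPF.nat_mul_inv_mem_finExp (h1 : ∀ n, 1 < β n) (hPF : PropertyPF β) {j : ℕ}
    (hj : 1 ≤ j) (k : ℕ) (hk : k * (entryProd β j)⁻¹ < 1) :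
    k * (entryProd β j)⁻¹ ∈ FinExp β := by
  have hpos := inv_pos.2 (entryProd_pos h1 j)
  induction k with
  | zero =>
    exact mem_finExp_of_remainder_eq_zero (by simp) (n := 0) (by simp [remainder])
  | succ k ih =>
    push_cast [add_mul, one_mul] at hk ⊢
    exact hPF _ (ih (by linarith)) _ (inv_entryProd_mem_finExp h1 hj) ⟨by positivity, hk⟩

/-- The relation that carries the whole argument. The least multiple of a small weight
`(entryProd β j)⁻¹` above the weight `(entryProd β n)⁻¹` has a finite greedy expansion by
Property (PF). This expansion starts with a single digit `1` at the larger weight, followed by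
zeros up to and including the position of the small weight. -/
lemma PropertyPF.exists_relation (hβ : IsCantorRealBase β) (hPF : PropertyPF β) {n : ℕ}
    (hn : 1 ≤ n) :
    ∀ᶠ j in Filter.atTop, n < j ∧ ∃ (d : ℕ → ℕ) (N₀ : ℕ), (∀ i, (d i : ℝ) ≤ β i) ∧
      ∀ N, N₀ ≤ N → (⌈entryProd β j / entryProd β n⌉₊ : ℝ) * (entryProd β j)⁻¹
        = (entryProd β n)⁻¹ + ∑ i ∈ Finset.Ico j N, (d i : ℝ) * (entryProd β (i + 1))⁻¹ := by
  have h1 := hβ.1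
  obtain ⟨m, rfl⟩ : ∃ m, n = m + 1 := ⟨n - 1, by omega⟩
  have hm0 := entryProd_pos h1 m
  have hn0 := entryProd_pos h1 (m + 1)
  have hmn : (entryProd β (m + 1))⁻¹ < (entryProd β m)⁻¹ :=
    inv_strictAnti₀ hm0 (entryProd_strictMono h1 (Nat.lt_succ_self m))
  have hlim : Filter.Tendsto (fun j => (entryProd β j)⁻¹) Filter.atTop (nhds 0) :=
    tendsto_inv_atTop_zero.comp hβ.2
  filter_upwards [hlim.eventually_lt_const (sub_pos.2 hmn),
    hlim.eventually_lt_const (inv_pos.2 hn0), Filter.eventually_gt_atTop (m + 1)] with j hj1 hj2 hj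
  refine ⟨hj, ?_⟩
  have hj0 := entryProd_pos h1 j
  set k := ⌈entryProd β j / entryProd β (m + 1)⌉₊ with hk
  set y := (k : ℝ) * (entryProd β j)⁻¹ with hy
  have hlow : (entryProd β (m + 1))⁻¹ ≤ y := by
    have := mul_le_mul_of_nonneg_right (Nat.le_ceil (entryProd β j / entryProd β (m + 1)))
      (inv_pos.2 hj0).le
    calc _ = entryProd β j / entryProd β (m + 1) * (entryProd β j)⁻¹ := by field_simp
      _ ≤ _ := this
  have hupp : y < (entryProd β (m + 1))⁻¹ + (entryProd β j)⁻¹ := by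
    have := mul_lt_mul_of_pos_right (Nat.ceil_lt_add_one
      (div_pos hj0 hn0).le) (inv_pos.2 hj0)
    calc y < (entryProd β j / entryProd β (m + 1) + 1) * (entryProd β j)⁻¹ := this
      _ = _ := by field_simp
  have hym : y < (entryProd β m)⁻¹ := by linarith
  have hy0 : 0 ≤ y := by positivity
  have hm1 : (entryProd β m)⁻¹ ≤ 1 := by
    refine inv_le_one_of_one_le₀ ?_
    rw [← entryProd_zero (β := β)]
    exact (entryProd_strictMono h1).monotone (Nat.zero_le m)
  have hyF : y ∈ FinExp β := hPF.nat_mul_inv_mem_finExp h1 (by omega) k (by linarith)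
  have hrm : ∀ i ≤ m, remainder β y i = entryProd β i * y := fun i hi =>
    remainder_eq_entryProd_mul h1 hy0 (m := m)
      (by rwa [mul_comm, ← lt_div_iff₀ hm0, one_div]) hi
  have hz0 : 0 ≤ y - (entryProd β (m + 1))⁻¹ := sub_nonneg.2 hlow
  have hdm : expansion β y m = 1 := by
    rw [expansion, hrm m le_rfl, ← mul_assoc, mul_comm (β m), ← entryProd_succ,
      Nat.floor_eq_iff (by positivity)]
    constructor
    · rw [Nat.cast_one, ← mul_inv_cancel₀ hn0.ne']
      exact mul_le_mul_of_nonneg_left hlow hn0.le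
    · calc _ < entryProd β (m + 1) * (2 * (entryProd β (m + 1))⁻¹) :=
            mul_lt_mul_of_pos_left (by linarith) hn0
        _ = _ := by field_simp; norm_num
  have hlt : entryProd β j * (y - (entryProd β (m + 1))⁻¹) < 1 := by
    rw [mul_comm, ← lt_div_iff₀ hj0, one_div]; linarith
  have hrj : remainder β y j = entryProd β j * (y - (entryProd β (m + 1))⁻¹) := by
    have key : ∀ i, m + 1 ≤ i → i ≤ j →
        remainder β y i = entryProd β i * (y - (entryProd β (m + 1))⁻¹) := by
      intro i hi
      induction i, hi using Nat.le_induction with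
      | base =>
        intro _
        rw [remainder_succ, hdm, hrm m le_rfl, mul_sub, mul_inv_cancel₀ hn0.ne', entryProd_succ]
        push_cast; ring
      | succ i hi ih =>
        intro hij
        have h2 : β i * remainder β y i
            = entryProd β (i + 1) * (y - (entryProd β (m + 1))⁻¹) := by
          rw [ih (by omega), entryProd_succ (n := i)]; ring
        have h3 := lt_of_le_of_lt (mul_le_mul_of_nonneg_right
          ((entryProd_strictMono h1).monotone hij) hz0) hlt
        rw [remainder_succ, expansion, h2, Nat.floor_eq_zero.2 h3]
        simp
    exact key j hj.le le_rfl
  obtain ⟨N₀, hN₀⟩ := exists_eq_sum_of_mem_finExp hβ hyF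
  refine ⟨expansion β y, max N₀ j, fun i => expansion_le h1 hyF.1 i, fun N hN => ?_⟩
  have e1 := hN₀ N (by omega)
  have e2 := sum_expansion_add_remainder h1 y j
  rw [← Finset.sum_range_add_sum_Ico _ (show j ≤ N by omega)] at e1
  have e3 : remainder β y j * (entryProd β j)⁻¹ = y - (entryProd β (m + 1))⁻¹ := by
    rw [hrj]; field_simp
  linarith

/-! ### Integrality of the product of a period -/

lemma IsAlternateBase.one_lt_periodProduct (hβ : IsAlternateBase β p) : 1 < periodProduct β p :=
  one_lt_entryProd hβ.2.1.1 hβ.1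

/-- By the basic relation, every weight is an integral combination of smaller ones. Hence
multiplication by the product of a period preserves the group generated by the weights in a long
enough window of positions, and this group is finitely generated. -/
lemma PropertyPF.isIntegral_periodProduct (hβ : IsAlternateBase β p) (hPF : PropertyPF β) :
    IsIntegral ℤ (periodProduct β p) := by
  obtain ⟨hp, hC, hper⟩ := hβ
  have hrel : ∀ n, 1 ≤ n → ∀ᶠ N in Filter.atTop, (entryProd β n)⁻¹ ∈
      Submodule.span ℤ ((fun i => (entryProd β i)⁻¹) '' Set.Ioc n N) := by
    intro n hn
    obtain ⟨j, hj, d, N₀, -, hd⟩ := (hPF.exists_relation hC hn).exists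
    filter_upwards [Filter.eventually_ge_atTop (N₀ + j + 1)] with N hN
    have hmem : ∀ i, n < i → i ≤ N → (entryProd β i)⁻¹ ∈
        Submodule.span ℤ ((fun i => (entryProd β i)⁻¹) '' Set.Ioc n N) := fun i h1 h2 =>
      Submodule.subset_span ⟨i, ⟨h1, h2⟩, rfl⟩
    have hcast : ∀ (k : ℕ) (x : ℝ), (k : ℝ) * x = (k : ℤ) • x := fun k x => by simp
    rw [← sub_eq_iff_eq_add.2 (hd (N - 1) (by omega))]
    refine Submodule.sub_mem _ ?_ (Submodule.sum_mem _ fun i hi => ?_)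
    · rw [hcast]
      exact Submodule.smul_mem _ _ (hmem j hj (by omega))
    · rw [Finset.mem_Ico] at hi
      rw [hcast]
      exact Submodule.smul_mem _ _ (hmem (i + 1) (by omega) (by omega))
  obtain ⟨N, hN, hNp⟩ := (((Finset.Icc 1 p).eventually_all.2 fun n hn =>
    hrel n (Finset.mem_Icc.1 hn).1).and (Filter.eventually_gt_atTop p)).exists
  set M : Submodule ℤ ℝ := Submodule.span ℤ ((fun i => (entryProd β i)⁻¹) '' Set.Ioc p (N + p))
    with hM
  have hgen : ∀ i, p < i → i ≤ N + p → (entryProd β i)⁻¹ ∈ M := fun i h1 h2 =>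
    Submodule.subset_span ⟨i, ⟨h1, h2⟩, rfl⟩
  have hdown : ∀ m ≤ p, ∀ i, p - m < i → i ≤ N → (entryProd β i)⁻¹ ∈ M := by
    intro m
    induction m with
    | zero => exact fun _ i h1 h2 => hgen i (by omega) (by omega)
    | succ m ih =>
      intro hm i h1 h2
      rcases Nat.lt_or_ge (p - m) i with h | h
      · exact ih (by omega) i h h2
      · refine Submodule.span_le.2 ?_ (hN i (Finset.mem_Icc.2 ⟨by omega, by omega⟩))
        rintro _ ⟨i', ⟨h3, h4⟩, rfl⟩
        exact ih (by omega) i' (by omega) h4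
  have hδ := (IsAlternateBase.one_lt_periodProduct ⟨hp, hC, hper⟩)
  refine isIntegral_of_smul_mem_submodule M ?_ (Submodule.fg_span ((Set.finite_Ioc _ _).image _))
    _ fun x hx => ?_
  · refine fun h => (inv_pos.2 (entryProd_pos hC.1 (p + 1))).ne' ?_
    have := hgen (p + 1) (by omega) (by omega)
    rw [h] at this
    exact (Submodule.mem_bot ℤ).1 this
  · have hle : M ≤ M.comap (LinearMap.mulLeft ℤ (periodProduct β p)) := by
      refine Submodule.span_le.2 ?_
      rintro _ ⟨i, ⟨h1, h2⟩, rfl⟩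
      obtain ⟨i, rfl⟩ : ∃ i', i = i' + p := ⟨i - p, by omega⟩
      have : periodProduct β p * (entryProd β (i + p))⁻¹ = (entryProd β i)⁻¹ := by
        rw [entryProd_add_period hper, mul_inv, mul_inv_cancel_left₀ (by linarith)]
      change _ * _ ∈ M
      rw [this]
      exact hdown p le_rfl i (by omega) (by omega)
    exact hle hx

/-! ### Additive maps that are semilinear for the product of a period -/

lemma summable_of_scaled_period {a : ℕ → ℝ} {c : ℝ} (ha : ∀ n, 0 ≤ a n)
    (hc : c < 1) (h : ∀ n, a (n + p) = c * a n) : Summable a := by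
  refine summable_of_sum_range_le (c := (∑ i ∈ Finset.range p, a i) / (1 - c)) ha fun n => ?_
  rw [le_div_iff₀ (by linarith)]
  have h1 : ∑ i ∈ Finset.range (p + n), a i
      = ∑ i ∈ Finset.range p, a i + c * ∑ i ∈ Finset.range n, a i := by
    rw [Finset.sum_range_add, Finset.mul_sum]
    congr 1
    exact Finset.sum_congr rfl fun i _ => by rw [add_comm, h]
  have h2 : ∑ i ∈ Finset.range n, a i ≤ ∑ i ∈ Finset.range (p + n), a i :=
    Finset.sum_le_sum_of_subset_of_nonneg (by simp) fun i _ _ => ha i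
  linarith

/-- An additive map that turns multiplication by the product of a period into multiplication by
a number of modulus larger than `1` is linear on the weights. Indeed, applying it to the basic
relation gives an error bounded by a tail of a convergent series, so that `entryProd β n * φ (w n)`,
with `w n` the `n`-th weight, is the limit of `entryProd β j * φ (w j)` for every `n`. -/
lemma PropertyPF.exists_map_inv_eq (hβ : IsAlternateBase β p) (hPF : PropertyPF β) (φ : ℝ →+ ℂ)
    {γ : ℂ} (hγ : 1 < ‖γ‖) (hφ : ∀ x, φ (periodProduct β p * x) = γ * φ x) :
    ∃ c : ℂ, ∀ n, 1 ≤ n → φ (entryProd β n)⁻¹ = c * (entryProd β n : ℂ)⁻¹ := by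
  have hδ := hβ.one_lt_periodProduct
  obtain ⟨hp, hC, hper⟩ := hβ
  have h1 := hC.1
  have hpos := entryProd_pos h1
  set w : ℕ → ℂ := fun n => φ (entryProd β n)⁻¹ with hw
  have hγ0 : γ ≠ 0 := norm_pos_iff.1 (by linarith)
  have hwp : ∀ n, ‖w (n + p)‖ = ‖γ‖⁻¹ * ‖w n‖ := fun n => by
    have : w n = γ * w (n + p) := by
      simp only [hw, ← hφ]
      rw [entryProd_add_period hper, mul_inv, mul_inv_cancel_left₀ (by linarith)]
    rw [this, norm_mul, inv_mul_cancel_left₀ (by simpa using hγ0)]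
  have hsum : Summable fun n => ‖w n‖ :=
    summable_of_scaled_period (fun n => norm_nonneg _) (inv_lt_one_of_one_lt₀ hγ) hwp
  obtain ⟨D, hD0, hD⟩ : ∃ D, 0 ≤ D ∧ ∀ i, β i ≤ D := by
    refine ⟨∑ k ∈ Finset.range p, β k,
      Finset.sum_nonneg fun k _ => (zero_lt_one.trans (h1 k)).le, fun i => ?_⟩
    rw [← hper.map_mod_nat i]
    exact Finset.single_le_sum (f := β) (fun k _ => (zero_lt_one.trans (h1 k)).le)
      (Finset.mem_range.2 (Nat.mod_lt i hp))
  have htend : ∀ n, 1 ≤ n →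
      Filter.Tendsto (fun j => (entryProd β j : ℂ) * w j) Filter.atTop
        (nhds ((entryProd β n : ℂ) * w n)) := by
    intro n hn
    have hkw : Filter.Tendsto (fun j => (⌈entryProd β j / entryProd β n⌉₊ : ℂ) * w j)
        Filter.atTop (nhds (w n)) := by
      rw [tendsto_iff_norm_sub_tendsto_zero]
      have htail := ((tendsto_sum_nat_add fun n => ‖w n‖).const_mul D)
      rw [mul_zero] at htail
      refine squeeze_zero' (Filter.Eventually.of_forall fun j => norm_nonneg _) ?_ htail
      filter_upwards [hPF.exists_relation hC hn] with j hj
      obtain ⟨hnj, d, N₀, hd, hrel⟩ := hj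
      have e := congrArg φ (hrel (max N₀ j) (le_max_left _ _))
      have hnat : ∀ (k : ℕ) (x : ℝ), φ (k * x) = k * φ x := fun k x => by
        rw [← nsmul_eq_mul, map_nsmul, nsmul_eq_mul]
      rw [map_add, hnat, map_sum] at e
      simp only [hnat] at e
      rw [sub_eq_iff_eq_add'.2 e]
      calc _ ≤ ∑ i ∈ Finset.Ico j (max N₀ j), D * ‖w (i + 1)‖ := by
            refine norm_sum_le_of_le _ fun i _ => ?_
            rw [norm_mul, Complex.norm_natCast]
            exact mul_le_mul_of_nonneg_right ((hd i).trans (hD i)) (norm_nonneg _)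
        _ = D * ∑ i ∈ Finset.range (max N₀ j - j), ‖w (i + 1 + j)‖ := by
            rw [Finset.sum_Ico_eq_sum_range, Finset.mul_sum]
            refine Finset.sum_congr rfl fun i _ => by rw [show j + i + 1 = i + 1 + j by ring]
        _ ≤ D * ∑ i ∈ Finset.range (max N₀ j - j + 1), ‖w (i + j)‖ := by
            refine mul_le_mul_of_nonneg_left ?_ hD0
            rw [Finset.sum_range_succ']
            exact le_add_of_nonneg_right (norm_nonneg _)
        _ ≤ D * ∑' i, ‖w (i + j)‖ := by
            refine mul_le_mul_of_nonneg_left ?_ hD0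
            exact ((summable_nat_add_iff j).2 hsum).sum_le_tsum _ fun i _ => norm_nonneg _
    have hratio : Filter.Tendsto (fun j => (⌈(entryProd β n)⁻¹ * entryProd β j⌉₊ : ℝ)
        / entryProd β j) Filter.atTop (nhds (entryProd β n)⁻¹) :=
      (tendsto_nat_ceil_mul_div_atTop (inv_pos.2 (hpos n)).le).comp hC.2
    have hratio' := (hratio.inv₀ (inv_pos.2 (hpos n)).ne').ofReal
    have := hratio'.mul hkw
    rw [inv_inv] at this
    refine this.congr fun j => ?_
    have hk : (⌈entryProd β j / entryProd β n⌉₊ : ℂ) ≠ 0 := by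
      exact_mod_cast (Nat.ceil_pos.2 (div_pos (hpos j) (hpos n))).ne'
    rw [inv_mul_eq_div]
    push_cast
    field_simp
  refine ⟨(entryProd β 1 : ℂ) * w 1, fun n hn => ?_⟩
  have hn0 : (entryProd β n : ℂ) ≠ 0 := by exact_mod_cast (hpos n).ne'
  rw [tendsto_nhds_unique (htend 1 le_rfl) (htend n hn)]
  rw [mul_comm, inv_mul_cancel_left₀ hn0]

/-- Embeddings of `ℚ(δ)` give additive maps as in `PropertyPF.exists_map_inv_eq`, after composition
with a `ℚ(δ)`-linear projection `ℝ → ℚ(δ)`. Such a composite is the identity on the weights. -/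
lemma PropertyPF.eq_of_one_lt_norm (hβ : IsAlternateBase β p) (hPF : PropertyPF β) {δ : ℝ}
    (hδp : periodProduct β p = δ) (ψ : ℚ⟮δ⟯ →+* ℂ) (l : ℝ →ₗ[ℚ⟮δ⟯] ℚ⟮δ⟯) (hl : l 1 = 1)
    (hψ : 1 < ‖ψ (IntermediateField.AdjoinSimple.gen ℚ δ)‖) :
    ψ (IntermediateField.AdjoinSimple.gen ℚ δ) = δ ∧
      ∀ n, 1 ≤ n → ψ (l (entryProd β n)⁻¹) = (entryProd β n : ℂ)⁻¹ := by
  have hδ := hβ.one_lt_periodProduct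
  have hpow := entryProd_mul_period hβ.2.2
  rw [hδp] at hδ hpow
  set g := IntermediateField.AdjoinSimple.gen ℚ δ with hg
  have hgδ : ∀ x : ℝ, l (δ * x) = g * l x := fun x => by
    rw [← smul_eq_mul g, ← map_smul]
    rfl
  let φ : ℝ →+ ℂ := ψ.toAddMonoidHom.comp l.toAddMonoidHom
  have hφ : ∀ x, φ (δ * x) = ψ g * φ x := fun x => by
    change ψ (l _) = _ * ψ (l x)
    rw [hgδ, map_mul]
  have hφ1 : φ 1 = 1 := by
    change ψ (l 1) = 1
    rw [hl, map_one]
  obtain ⟨c, hc⟩ := hPF.exists_map_inv_eq hβ φ hψ (by rwa [hδp])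
  have hδ0 : (δ : ℂ) ≠ 0 := by exact_mod_cast (by linarith : δ ≠ 0)
  -- Evaluating `φ` at `1 = δ * δ⁻¹` and at `δ⁻¹ = δ * δ⁻²` determines first `ψ g`, then `c`.
  have ha := hc (p * 1) (by linarith [hβ.1])
  have hb := hc (p * 2) (by linarith [hβ.1])
  rw [hpow, pow_one] at ha
  rw [hpow] at hb
  have e1 : 1 = ψ g * (c * (δ : ℂ)⁻¹) := by
    rw [← ha, ← hφ, mul_inv_cancel₀ (by linarith), hφ1]
  have e2 : c * (δ : ℂ)⁻¹ = ψ g * (c * ((δ ^ 2 : ℝ) : ℂ)⁻¹) := by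
    rw [← ha, ← hb, ← hφ]
    congr 1
    field_simp
  have hc0 : c ≠ 0 := by
    rintro rfl
    simp at e1
  have hψδ : ψ g = δ := by
    push_cast at e2
    field_simp at e2
    exact e2.symm
  refine ⟨hψδ, fun n hn => ?_⟩
  have hc1 : c = 1 := by
    rw [hψδ] at e1
    field_simp at e1
    exact e1.symm
  have := hc n hn
  rw [hc1, one_mul] at this
  exact this

lemma exists_linear_projection (K : IntermediateField ℚ ℝ) : ∃ l : ℝ →ₗ[K] K, l 1 = 1 := by
  obtain ⟨l, hl⟩ := (Algebra.linearMap K ℝ).exists_leftInverse_of_injective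
    (LinearMap.ker_eq_bot.2 (algebraMap K ℝ).injective)
  refine ⟨l, ?_⟩
  simpa using LinearMap.congr_fun hl 1

lemma PropertyPF.norm_le_one_of_mem_otherConjugates (hβ : IsAlternateBase β p)
    (hPF : PropertyPF β) {γ : ℂ} (hγ : γ ∈ otherConjugates (periodProduct β p)) : ‖γ‖ ≤ 1 := by
  by_contra! h
  have hint : IsIntegral ℚ (periodProduct β p) := (hPF.isIntegral_periodProduct hβ).tower_top
  obtain ⟨l, hl⟩ := exists_linear_projection ℚ⟮periodProduct β p⟯
  have hroot : γ ∈ (minpoly ℚ (periodProduct β p)).aroots ℂ := by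
    have := hγ.1
    rwa [Polynomial.rootSet, Finset.mem_coe, Multiset.mem_toFinset] at this
  let ψ := (IntermediateField.algHomAdjoinIntegralEquiv ℚ hint (K := ℂ)).symm ⟨γ, hroot⟩
  have hψ : ψ (IntermediateField.AdjoinSimple.gen ℚ (periodProduct β p)) = γ :=
    IntermediateField.algHomAdjoinIntegralEquiv_symm_apply_gen ℚ hint ⟨γ, hroot⟩
  have := (hPF.eq_of_one_lt_norm hβ rfl ψ.toRingHom l hl (by
    change 1 < ‖ψ _‖
    rwa [hψ])).1
  exact hγ.2 (hψ.symm.trans this)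

lemma PropertyPF.isPisot_or_isSalem (hβ : IsAlternateBase β p) (hPF : PropertyPF β) :
    IsPisot (periodProduct β p) ∨ IsSalem (periodProduct β p) := by
  have hint := hPF.isIntegral_periodProduct hβ
  have hle := fun γ hγ => hPF.norm_le_one_of_mem_otherConjugates hβ (γ := γ) hγ
  by_cases h : ∃ γ ∈ otherConjugates (periodProduct β p), ‖γ‖ = 1
  · exact Or.inr ⟨hint, hβ.one_lt_periodProduct, hle, h⟩
  · push Not at h
    exact Or.inl ⟨hint, hβ.one_lt_periodProduct, fun γ hγ => lt_of_le_of_ne (hle γ hγ) (h γ hγ)⟩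

lemma PropertyPF.mem_adjoin_periodProduct (hβ : IsAlternateBase β p) (hPF : PropertyPF β) (i : ℕ) :
    β i ∈ ℚ⟮periodProduct β p⟯ := by
  obtain ⟨l, hl⟩ := exists_linear_projection ℚ⟮periodProduct β p⟯
  have hδ := hβ.one_lt_periodProduct
  have key := (hPF.eq_of_one_lt_norm hβ rfl (identicalEmbedding _) l hl (by
    change 1 < ‖((periodProduct β p : ℝ) : ℂ)‖
    rw [Complex.norm_real, Real.norm_of_nonneg (by linarith)]
    exact hδ)).2
  have hmem : ∀ n, 1 ≤ n → entryProd β n ∈ ℚ⟮periodProduct β p⟯ := fun n hn => by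
    have h2 : ((l (entryProd β n)⁻¹ : ℚ⟮periodProduct β p⟯) : ℝ) = (entryProd β n)⁻¹ := by
      have := key n hn
      rw [← Complex.ofReal_inv] at this
      exact Complex.ofReal_injective this
    rw [← inv_inv (entryProd β n), ← h2]
    exact inv_mem (SetLike.coe_mem _)
  rw [← hβ.2.2 i]
  have hpos := entryProd_pos hβ.2.1.1 (i + p)
  have : β (i + p) = entryProd β (i + p + 1) / entryProd β (i + p) := by
    rw [entryProd_succ]; field_simp
  rw [this]
  have := hβ.1
  exact div_mem (hmem _ (by omega)) (hmem _ (by omega))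

/-! ### Consequences of Property (F) -/

lemma PropertyF.propertyPF (hF : PropertyF β) : PropertyPF β := fun x hx y hy => (hF x hx y hy).1

/-- After its first digit, the expansion of `1` in a shifted base is that of the fractional part
of an entry of the base. Scaled down, this fractional part is a difference of two numbers with
finite expansions. -/
lemma PropertyF.expansion_one_mem_finiteSequences (hβ : IsAlternateBase β p) (hF : PropertyF β)
    (ℓ : ℕ) : expansion (shift β ℓ) 1 ∈ finiteSequences := by
  obtain ⟨hp, hC, hper⟩ := hβ
  have h1 := hC.1
  have hshift : shift β ℓ = shift β (ℓ + p) := funext fun n => by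
    rw [shift, shift, add_right_comm, hper]
  -- The shift by a whole period makes the number `(entryProd β L)⁻¹` smaller than `1`.
  rw [hshift]
  have hL : 1 ≤ ℓ + p := by omega
  generalize ℓ + p = L at hL
  have hb := zero_lt_one.trans (h1 L)
  have hL0 := entryProd_pos h1 L
  have hL1 := entryProd_pos h1 (L + 1)
  have hinv : (entryProd β L)⁻¹ < 1 := inv_lt_one_of_one_lt₀ (one_lt_entryProd h1 hL)
  have hfl := Nat.floor_le hb.le
  have hfl' := Nat.lt_floor_add_one (β L)
  have hdiff : (entryProd β L)⁻¹ - ⌊β L⌋₊ * (entryProd β (L + 1))⁻¹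
      = (β L - ⌊β L⌋₊) * (entryProd β (L + 1))⁻¹ := by
    rw [entryProd_succ]; field_simp
  have hz0 : 0 ≤ (β L - ⌊β L⌋₊) * (entryProd β (L + 1))⁻¹ :=
    mul_nonneg (by linarith) (inv_pos.2 hL1).le
  have hy0 : 0 ≤ ⌊β L⌋₊ * (entryProd β (L + 1))⁻¹ :=
    mul_nonneg (Nat.cast_nonneg _) (inv_pos.2 hL1).le
  have hz := (hF _ (inv_entryProd_mem_finExp h1 hL) _
    (hF.propertyPF.nat_mul_inv_mem_finExp h1 (j := L + 1) (by omega) ⌊β L⌋₊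
      (by linarith))).2 ⟨by linarith, by linarith⟩
  rw [hdiff] at hz
  obtain ⟨N, hN⟩ := exists_remainder_eq_zero hC hz
  have hr := remainder_eq_entryProd_mul h1 hz0 (m := L + 1) (by
    rw [mul_left_comm, mul_inv_cancel₀ hL1.ne', mul_one]; linarith) le_rfl
  rw [mul_left_comm, mul_inv_cancel₀ hL1.ne', mul_one] at hr
  refine expansion_mem_finiteSequences (n := 1 + N) ?_
  have hone : remainder (shift β L) 1 1 = β L - ⌊β L⌋₊ := by
    simp [remainder, shift]
  have hss : shift (shift β L) 1 = shift β (L + 1) := funext fun n => by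
    simp [shift, add_assoc]
  rw [remainder_shift, hone, hss, ← hr, ← remainder_shift]
  exact remainder_eq_zero_of_le hN (by omega)

lemma eventuallyPeriodic_of_mem_finiteSequences {s : ℕ → ℕ} (hs : s ∈ finiteSequences) :
    EventuallyPeriodic s := by
  obtain ⟨N, hN⟩ := hs.bddAbove
  have h0 : ∀ n, N < n → s n = 0 := fun n hn => by
    by_contra h
    exact absurd (hN (Function.mem_support.2 h)) (by omega)
  exact ⟨N + 1, 1, le_rfl, fun n hn => by rw [h0 n (by omega), h0 (n + 1) (by omega)]⟩

lemma PropertyF.isSimpleParryAlternateBase (hβ : IsAlternateBase β p) (hF : PropertyF β) :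
    IsSimpleParryAlternateBase β p :=
  ⟨⟨hβ, fun ℓ _ => eventuallyPeriodic_of_mem_finiteSequences
    (hF.expansion_one_mem_finiteSequences hβ ℓ)⟩,
    fun ℓ _ => hF.expansion_one_mem_finiteSequences hβ ℓ⟩

/-- A number with a finite expansion is a non-negative combination of the weights, so it is mapped
to a non-negative number by an embedding that makes the base positive. -/
lemma map_re_nonneg_of_mem_finExp (hC : IsCantorRealBase β) {K : IntermediateField ℚ ℝ}
    {b : ℕ → K} (hb : ∀ i, (b i : ℝ) = β i) (ψ : K →+* ℂ) (hψ : ∀ i, IsPositive (ψ (b i)))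
    {u : K} (hu : (u : ℝ) ∈ FinExp β) : 0 ≤ (ψ u).re := by
  obtain ⟨N, hN⟩ := exists_eq_sum_of_mem_finExp hC hu
  choose r hr0 hr using hψ
  have hu' : u = ∑ i ∈ Finset.range N,
      (expansion β u i : K) * (∏ k ∈ Finset.range (i + 1), b k)⁻¹ := by
    apply Subtype.ext
    refine (hN N le_rfl).trans ?_
    simp [entryProd, hb]
  have hψu : ψ u = ((∑ i ∈ Finset.range N,
      (expansion β u i : ℝ) * (∏ k ∈ Finset.range (i + 1), r k)⁻¹ : ℝ) : ℂ) := by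
    refine (congrArg ψ hu').trans ?_
    simp [hr]
  rw [hψu, Complex.ofReal_re]
  exact Finset.sum_nonneg fun i _ => mul_nonneg (Nat.cast_nonneg _)
    (inv_nonneg.2 (Finset.prod_nonneg fun k _ => (hr0 k).le))

/-- An embedding that makes the base positive preserves, by Property (F), the sign of `s - t * δ`
for all natural numbers `s` and `t`. Hence it fixes `δ`. -/
lemma PropertyF.eq_identicalEmbedding (hβ : IsAlternateBase β p) (hF : PropertyF β) {δ : ℝ}
    (hδp : periodProduct β p = δ) {b : ℕ → ℚ⟮δ⟯} (hb : ∀ i, (b i : ℝ) = β i)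
    (ψ : ℚ⟮δ⟯ →+* ℂ) (hψ : ∀ i, IsPositive (ψ (b i))) :
    ψ = identicalEmbedding δ := by
  have hδ := hβ.one_lt_periodProduct
  obtain ⟨hp, hC, hper⟩ := hβ
  have hpow := entryProd_mul_period hper
  rw [hδp] at hδ hpow
  set g := IntermediateField.AdjoinSimple.gen ℚ δ with hg
  have hgδ : (g : ℝ) = δ := rfl
  obtain ⟨η, hη0, hη⟩ : IsPositive (ψ g) := by
    choose r hr0 hr using hψ
    refine ⟨∏ k ∈ Finset.range p, r k, Finset.prod_pos fun k _ => hr0 k, ?_⟩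
    have : g = ∏ k ∈ Finset.range p, b k := by
      apply Subtype.ext
      refine hδp.symm.trans ?_
      simp [periodProduct, hb]
    rw [this, map_prod]
    simp [hr]
  have hmem : ∀ k : ℕ, ∀ᶠ m : ℕ in Filter.atTop, (k : ℝ) * (δ ^ m)⁻¹ ∈ FinExp β := by
    intro k
    have : Filter.Tendsto (fun m : ℕ => (k : ℝ) * (δ ^ m)⁻¹) Filter.atTop (nhds 0) := by
      simpa using (tendsto_inv_atTop_zero.comp (tendsto_pow_atTop_atTop_of_one_lt hδ)).const_mul
        (k : ℝ)
    filter_upwards [this.eventually_lt_const one_pos, Filter.eventually_ge_atTop 1] with m hm hm1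
    rw [← hpow] at hm ⊢
    exact hF.propertyPF.nat_mul_inv_mem_finExp hC.1 (Nat.mul_pos hp hm1) k hm
  have hsub : ∀ s t : ℕ, ∃ m : ℕ,
      (s : ℝ) * (δ ^ m)⁻¹ ∈ FinExp β ∧ (t : ℝ) * δ * (δ ^ m)⁻¹ ∈ FinExp β := by
    intro s t
    obtain ⟨m, hs, ht⟩ :=
      (((Filter.tendsto_add_atTop_nat 1).eventually (hmem s)).and (hmem t)).exists
    refine ⟨m + 1, hs, ?_⟩
    have : (t : ℝ) * δ * (δ ^ (m + 1))⁻¹ = t * (δ ^ m)⁻¹ := by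
      rw [pow_succ]; field_simp
    rwa [this]
  have hnonneg : ∀ (u : ℚ⟮δ⟯) (v : ℝ) (m : ℕ), ψ u = v → (u : ℝ) * (δ ^ m)⁻¹ ∈ FinExp β →
      0 ≤ v := by
    intro u v m hv hu
    have h := map_re_nonneg_of_mem_finExp hC hb ψ hψ (u := u * (g ^ m)⁻¹) hu
    rw [map_mul, map_inv₀, map_pow, hη, hv, ← Complex.ofReal_pow, ← Complex.ofReal_inv,
      ← Complex.ofReal_mul, Complex.ofReal_re] at h
    exact nonneg_of_mul_nonneg_left h (by positivity)
  have hle : ∀ s t : ℕ, t * δ ≤ s → t * η ≤ s := by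
    intro s t hst
    obtain ⟨m, hs, ht⟩ := hsub s t
    have hd : (s - t * δ) * (δ ^ m)⁻¹ = s * (δ ^ m)⁻¹ - t * δ * (δ ^ m)⁻¹ := sub_mul _ _ _
    have h0 : 0 ≤ (s - t * δ) * (δ ^ m)⁻¹ := mul_nonneg (by linarith) (by positivity)
    refine sub_nonneg.1 (hnonneg (s - t * g) _ m (by simp [hη]) ?_)
    have := (hF _ hs _ ht).2 ⟨by linarith, by linarith [hs.1.2, ht.1.1]⟩
    rw [← hd] at this
    simpa [hgδ] using this
  have hge : ∀ s t : ℕ, s ≤ t * δ → s ≤ t * η := by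
    intro s t hst
    obtain ⟨m, hs, ht⟩ := hsub s t
    have hd : (t * δ - s) * (δ ^ m)⁻¹ = t * δ * (δ ^ m)⁻¹ - s * (δ ^ m)⁻¹ := sub_mul _ _ _
    have h0 : 0 ≤ (t * δ - s) * (δ ^ m)⁻¹ := mul_nonneg (by linarith) (by positivity)
    refine sub_nonneg.1 (hnonneg (t * g - s) _ m (by simp [hη]) ?_)
    have := (hF _ ht _ hs).2 ⟨by linarith, by linarith [hs.1.1, ht.1.2]⟩
    rw [← hd] at this
    simpa [hgδ] using this
  have hfrac : ∀ q : ℚ, (0 : ℝ) < q → ∃ s t : ℕ, (0 : ℝ) < t ∧ (q : ℝ) = s / t := by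
    intro q hq
    have hq0 : 0 ≤ q.num := Rat.num_nonneg.2 (by exact_mod_cast hq.le)
    refine ⟨q.num.toNat, q.den, by exact_mod_cast q.den_pos, ?_⟩
    rw [Rat.cast_def, ← Int.cast_natCast q.num.toNat, Int.toNat_of_nonneg hq0]
  have hηδ : η = δ := by
    rcases lt_trichotomy η δ with hlt | heq | hlt
    · obtain ⟨q, hq1, hq2⟩ := exists_rat_btwn hlt
      obtain ⟨s, t, ht, hst⟩ := hfrac q (by linarith)
      rw [hst, lt_div_iff₀ ht] at hq1
      rw [hst, div_lt_iff₀ ht] at hq2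
      linarith [hge s t (by linarith)]
    · exact heq
    · obtain ⟨q, hq1, hq2⟩ := exists_rat_btwn hlt
      obtain ⟨s, t, ht, hst⟩ := hfrac q (by linarith)
      rw [hst, lt_div_iff₀ ht] at hq1
      rw [hst, div_lt_iff₀ ht] at hq2
      linarith [hle s t (by linarith)]
  have halg : ψ.toRatAlgHom = (identicalEmbedding δ).toRatAlgHom :=
    IntermediateField.adjoin_algHom_ext ℚ fun x hx => by
      have hx' : x = δ := hx
      change ψ ⟨x, _⟩ = (x : ℂ)
      rw [show (⟨x, _⟩ : ℚ⟮δ⟯) = g from Subtype.ext hx', hη, hηδ, hx']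
  exact congrArg AlgHom.toRingHom halg

end CantorReal

theorem theorem1 (β : ℕ → ℝ) (p : ℕ) (hβ : CantorReal.IsAlternateBase β p) :
    (CantorReal.PropertyPF β →
      (CantorReal.IsPisot (CantorReal.periodProduct β p) ∨
        CantorReal.IsSalem (CantorReal.periodProduct β p)) ∧
      ∀ i < p, β i ∈ ℚ⟮CantorReal.periodProduct β p⟯) ∧
    (CantorReal.PropertyF β →
      CantorReal.IsSimpleParryAlternateBase β p ∧
      ∃ hmem : ∀ i < p, β i ∈ ℚ⟮CantorReal.periodProduct β p⟯,
        ∀ ψ : ℚ⟮CantorReal.periodProduct β p⟯ →+* ℂ,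
          ψ ≠ CantorReal.identicalEmbedding (CantorReal.periodProduct β p) →
          ¬ ∀ (i : ℕ) (hi : i < p), CantorReal.IsPositive (ψ ⟨β i, hmem i hi⟩)) := by
  refine ⟨fun hPF => ⟨hPF.isPisot_or_isSalem hβ, fun i _ => hPF.mem_adjoin_periodProduct hβ i⟩,
    fun hF => ⟨hF.isSimpleParryAlternateBase hβ,
      fun i _ => hF.propertyPF.mem_adjoin_periodProduct hβ i, fun ψ hne hpos => hne ?_⟩⟩
  refine hF.eq_identicalEmbedding hβ rfl
    (b := fun i => ⟨β i, hF.propertyPF.mem_adjoin_periodProduct hβ i⟩) (fun _ => rfl) ψ fun i => ?_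
  have hmod : (⟨β i, hF.propertyPF.mem_adjoin_periodProduct hβ i⟩ :
      ℚ⟮CantorReal.periodProduct β p⟯)
      = ⟨β (i % p), hF.propertyPF.mem_adjoin_periodProduct hβ (i % p)⟩ :=
    Subtype.ext (hβ.2.2.map_mod_nat i).symm
  rw [hmod]
  exact hpos (i % p) (Nat.mod_lt i hβ.1)
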